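/- For a finite set $S$ of points in the plane let $a_S$ be the number of distinct orderings of the points of $S$ by distance from a vantage point, as the vantage point ranges over all points of the plane not equidistant from two points of $S$; let $M(n)$ be the maximum of $a_S$ over all sets $S$ of $n$ points in the plane, and call $S$ free if $a_S=M(|S|)$. Let $m,k,l\ge 0$ be integers and let $C$ be a disjoint union of a free set $U$ of $m$ points in the plane and of sets $V_1,\dots,V_l$ of $k$ collinear points each, placed so that: - the perpendicular bisectors of distinct pairs of points of $C$ are distinct; - no two of these bisectors are parallel, except for bisectors of two pairs from the same $V_j$ (which necessarily are); - three distinct bisectors, not all determined by pairs of points of $U$, have a common point only if they are the bisectors of the three sides of a triangle. Let $n=m+kl$. Then $|C|=n$ and: 1. $$a_C=\tfrac1{24}\big(18k^2l^2m^2+12k^3l^3m-30k^2l^2m+3k^4l^4-10k^3l^3+21k^2l^2-3k^4l+10k^3l-9k^2l+12klm^3-30klm^2+42klm-12kl+3m^4-10m^3+21m^2-14m+24\big).$$ 2. $a_C=M(n)-l\,s(k,k-2)$, where $s(k,j)$ is the unsigned Stirling number of the first kind (the number of permutations of $k$ elements with exactly $j$ cycles, which is $0$ for $j<0$). -/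

import Mathlib

/-- The Euclidean plane. -/
abbrev Plane : Type := EuclideanSpace ℝ (Fin 2)

/-- The orderings of the points of `S` that arise as the vantage point `x` moves through the plane:
`p` comes before `q` when `p` is closer to `x` than `q` is.  Vantage points that are equidistant
from two points of `S` (those lying on a perpendicular bisector) are ignored. -/
def orderings (S : Finset Plane) : Set (S → S → Prop) :=
  {r | ∃ x : Plane, Set.InjOn (fun p => dist x p) (S : Set Plane) ∧
    r = fun p q : S => dist x (p : Plane) < dist x (q : Plane)}

/-- The number of distinct orderings of the points of `S`. -/
noncomputable def numOrderings (S : Finset Plane) : ℕ := (orderings S).ncard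

/-- The maximum number of orderings over all sets of `n` points in the plane. -/
noncomputable def maxOrderings (n : ℕ) : ℕ :=
  sSup {a | ∃ S : Finset Plane, S.card = n ∧ numOrderings S = a}

/-- The supremum in the definition of `maxOrderings` is an attained maximum. -/
theorem isGreatest_maxOrderings (n : ℕ) :
    IsGreatest {a | ∃ S : Finset Plane, S.card = n ∧ numOrderings S = a} (maxOrderings n) := by
  have hne : {a | ∃ S : Finset Plane, S.card = n ∧ numOrderings S = a}.Nonempty := by
    obtain ⟨S, hS⟩ := Infinite.exists_subset_card_eq Plane n
    exact ⟨_, S, hS, rfl⟩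
  have hbdd : BddAbove {a | ∃ S : Finset Plane, S.card = n ∧ numOrderings S = a} := by
    refine ⟨(2 ^ n) ^ n, ?_⟩
    rintro a ⟨S, hS, rfl⟩
    have h := Set.ncard_le_card (orderings S)
    have h2 : Nat.card (S → S → Prop) = (2 ^ n) ^ n := by
      simp [hS]
    exact h2 ▸ h
  exact ⟨Nat.sSup_mem hne hbdd, fun a ha => le_csSup hbdd ha⟩

/-- A finite set of points in the plane is in free position if it produces the maximum possible
number of orderings among all sets of the same size. -/
def IsFree (S : Finset Plane) : Prop := numOrderings S = maxOrderings S.card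

/-- The unordered pairs of distinct points of `S`. -/
def pairs (S : Finset Plane) : Set (Sym2 Plane) := {e | ¬ e.IsDiag ∧ ∀ p ∈ e, p ∈ S}

/-- The perpendicular bisector of an unordered pair of points. -/
noncomputable def bisector (e : Sym2 Plane) : AffineSubspace ℝ Plane :=
  Sym2.lift ⟨fun p q => AffineSubspace.perpBisector p q,
    fun p q => AffineSubspace.perpBisector_comm p q⟩ e

/-- The point set `C` consists of `m` points in free position (the set `U`) and `k * l` points
distributed onto `l` lines, with `k` points per line (the points on the `j`-th line form `V j`),
placed so that there are no parallelisms and no incidences among the perpendicular bisectors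
other than the forced ones. -/
structure IsParallelLinesConfig (m k l : ℕ) (U : Finset Plane) (V : Fin l → Finset Plane)
    (C : Finset Plane) : Prop where
  mem_iff : ∀ p, p ∈ C ↔ p ∈ U ∨ ∃ j, p ∈ V j
  card_free : U.card = m
  card_line : ∀ j, (V j).card = k
  disjoint_free : ∀ j, Disjoint U (V j)
  disjoint_line : ∀ i j, i ≠ j → Disjoint (V i) (V j)
  free : IsFree U
  collinear : ∀ j, Collinear ℝ (V j : Set Plane)
  /-- All perpendicular bisectors are distinct. -/
  distinct : ∀ e ∈ pairs C, ∀ f ∈ pairs C, e ≠ f → bisector e ≠ bisector f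
  /-- No two perpendicular bisectors are parallel, except those of two pairs of points on the
  same one of the `l` lines (which are always parallel). -/
  not_parallel : ∀ e ∈ pairs C, ∀ f ∈ pairs C, e ≠ f →
    (bisector e).Parallel (bisector f) → ∃ j, e ∈ pairs (V j) ∧ f ∈ pairs (V j)
  /-- Three perpendicular bisectors, not all determined by the free points, pass through a common
  point only if they are the perpendicular bisectors of the three sides of a triangle. -/
  concurrent : ∀ e ∈ pairs C, ∀ f ∈ pairs C, ∀ g ∈ pairs C, e ≠ f → f ≠ g → e ≠ g →
    ¬ (e ∈ pairs U ∧ f ∈ pairs U ∧ g ∈ pairs U) →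
    (∃ x, x ∈ bisector e ∧ x ∈ bisector f ∧ x ∈ bisector g) →
    ∃ a b c : Plane, ({e, f, g} : Set (Sym2 Plane)) = {s(a, b), s(b, c), s(c, a)}

/-- The unsigned Stirling number of the first kind `s(n, j)`, the number of permutations of `n`
elements with exactly `j` cycles; it is zero for negative `j`. -/
def stirlingOne (n : ℕ) (j : ℤ) : ℕ := if 0 ≤ j then Nat.stirlingFirst n j.toNat else 0

/-! Orderings of `S` correspond to regions of the arrangement of perpendicular bisectors of pairs of
`S`: crossing a bisector swaps two points. Regions are counted through sign patterns by deletion and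
restriction (`numRegions_insert`): a new line adds as many regions as the old arrangement cuts out
on it.

Add a point `p` to `S` (`numOrderings_insert`). On the bisector of `p, q`, equidistance from `p, q'`
is the same as equidistance from `q, q'`, so the other new bisectors meet this line only on
bisectors of `S`. Hence the gain is the sum over `q ∈ S` of the number of pieces into which the
bisectors of `S` cut the bisector of `p, q`. Each summand is at most `1 + |S|.choose 2`, with
equality when all bisectors of `S` cross the line at distinct points. Summing gives the upper bound
`generalCount`; it is attained because the bad positions of `p` form a null set. So `maxOrderings =
generalCount`.

For the configuration, start from `U`, whose count is maximal by freeness, and add the remaining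
points one at a time. When `p ∈ V j` joins `i` points of `V j`, the bisector of `p` with each of
them misses the `i.choose 2` bisectors parallel to it; nothing else is lost, since a forbidden
concurrency would be a triangle with only one side through `p`. Each line thus loses the sum of `i *
i.choose 2` over `i < k`, which obeys the recurrence of `s(k, k-2)`. -/

/-! ### Regions of an arrangement of affine functions -/

/-- The sign patterns of the functions `f i`, `i ∈ s`, at the points of `X` where none of them
vanishes; a pattern is recorded as the set of indices with positive sign. -/
def signPatterns {E ι : Type*} [AddCommGroup E] [Module ℝ E] (f : ι → E →ᵃ[ℝ] ℝ) (X : Set E)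
    (s : Finset ι) : Set (Finset ι) :=
  (fun x => s.filter fun i => 0 < f i x) '' {x | x ∈ X ∧ ∀ i ∈ s, f i x ≠ 0}

/-- The number of regions into which the zero loci of the `f i`, `i ∈ s`, cut `X`. -/
noncomputable def numRegions {E ι : Type*} [AddCommGroup E] [Module ℝ E] (f : ι → E →ᵃ[ℝ] ℝ)
    (X : Set E) (s : Finset ι) : ℕ := (signPatterns f X s).ncard

/-- A set that contains the line through any two of its points. -/
def IsFlat {E : Type*} [AddCommGroup E] [Module ℝ E] (X : Set E) : Prop :=
  ∀ x ∈ X, ∀ y ∈ X, ∀ t : ℝ, AffineMap.lineMap x y t ∈ X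

section Arrangement

variable {E ι : Type*} [AddCommGroup E] [Module ℝ E] {f : ι → E →ᵃ[ℝ] ℝ} {X : Set E}
  {s : Finset ι}

theorem mem_signPatterns {P : Finset ι} : P ∈ signPatterns f X s ↔
    ∃ x ∈ X, (∀ i ∈ s, f i x ≠ 0) ∧ (s.filter fun i => 0 < f i x) = P := by
  simp only [signPatterns, Set.mem_image, Set.mem_ofPred_eq, and_assoc]

theorem finite_signPatterns : (signPatterns f X s).Finite := by
  refine (s.powerset.finite_toSet).subset ?_
  rintro P hP
  obtain ⟨x, -, -, rfl⟩ := mem_signPatterns.1 hP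
  rw [Finset.mem_coe, Finset.mem_powerset]
  exact Finset.filter_subset _ _

/-- A short move from `x` along the line through `y` preserves the finitely many nonzero signs,
while `f i` varies linearly from `0`, so the direction of the move decides its sign. Only the sign
of `ε` matters. -/
theorem exists_perturbation (hX : IsFlat X) {i : ι} {x y : E} (hx : x ∈ X) (hy : y ∈ X)
    (hxs : ∀ j ∈ s, f j x ≠ 0) (hx0 : f i x = 0) (hy0 : f i y ≠ 0) (ε : ℝ) (hε : ε ≠ 0) :
    ∃ z ∈ X, 0 < ε * f i z ∧ ∀ j ∈ s, f j z ≠ 0 ∧ (0 < f j z ↔ 0 < f j x) := by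
  have hcont : ∀ j, Filter.Tendsto (fun t : ℝ => f j (AffineMap.lineMap x y t))
      (nhds 0) (nhds (f j x)) := by
    intro j
    have h : Continuous fun t : ℝ => f j (AffineMap.lineMap x y t) := by
      simp only [AffineMap.apply_lineMap]
      exact AffineMap.lineMap_continuous
    simpa using h.tendsto 0
  have hev : ∀ᶠ t : ℝ in nhds 0, ∀ j ∈ s, f j (AffineMap.lineMap x y t) ≠ 0 ∧
      (0 < f j (AffineMap.lineMap x y t) ↔ 0 < f j x) := by
    rw [Filter.eventually_all_finset]
    intro j hj
    rcases lt_or_gt_of_ne (hxs j hj) with h | h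
    · filter_upwards [(hcont j).eventually (gt_mem_nhds h)] with t ht
      exact ⟨ht.ne, by constructor <;> intro h' <;> linarith⟩
    · filter_upwards [(hcont j).eventually (lt_mem_nhds h)] with t ht
      exact ⟨ht.ne', by tauto⟩
  obtain ⟨δ, hδ, hball⟩ := Metric.eventually_nhds_iff.1 hev
  set c : ℝ := ε * f i y with hc
  have hc0 : c ≠ 0 := mul_ne_zero hε hy0
  -- At parameter `t` the value of `ε * f i` is `t * c`, so `t` takes the sign of `c`; `δ / 2` keeps
  -- it inside the ball.
  refine ⟨AffineMap.lineMap x y (δ / 2 * SignType.sign c), hX x hx y hy _, ?_, ?_⟩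
  · rw [AffineMap.apply_lineMap, hx0, AffineMap.lineMap_apply]
    have : 0 < δ / 2 * ((SignType.sign c : ℝ) * c) := by
      rw [sign_mul_self]; positivity
    simp only [vsub_eq_sub, sub_zero, smul_eq_mul, vadd_eq_add, add_zero]
    calc 0 < _ := this
      _ = _ := by rw [hc]; ring
  · refine hball ?_
    rw [Real.dist_eq, sub_zero, abs_mul, abs_of_pos (by positivity : 0 < δ / 2)]
    rcases lt_or_gt_of_ne hc0 with h | h <;> simp [h, hδ]

/-- Deletion and restriction. With `A` and `B` the old patterns seen on the positive and negative
sides of `f i`, the new patterns number `|A| + |B| = |A ∪ B| + |A ∩ B|`. The union is all old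
patterns, and the intersection consists of those visible on the zero locus. -/
theorem numRegions_insert [DecidableEq ι] (hX : IsFlat X) {i : ι} (hi : i ∉ s)
    (hne : ∃ y ∈ X, f i y ≠ 0) :
    numRegions f X (insert i s) = numRegions f X s + numRegions f (X ∩ {x | f i x = 0}) s := by
  obtain ⟨y, hy, hy0⟩ := hne
  set A := signPatterns f (X ∩ {x | 0 < f i x}) s
  set B := signPatterns f (X ∩ {x | f i x < 0}) s
  have hnot : ∀ {Y : Set E} {P}, P ∈ signPatterns f Y s → i ∉ P := by
    intro Y P hP
    obtain ⟨x, -, -, rfl⟩ := mem_signPatterns.1 hP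
    simp [hi]
  have h1 : signPatterns f X (insert i s) = (insert i '' A) ∪ B := by
    ext P
    constructor
    · intro hP
      obtain ⟨x, hx, hxs, rfl⟩ := mem_signPatterns.1 hP
      rw [Finset.forall_mem_insert] at hxs
      rcases lt_or_gt_of_ne hxs.1 with h | h
      · right
        refine mem_signPatterns.2 ⟨x, ⟨hx, h⟩, hxs.2, ?_⟩
        rw [Finset.filter_insert, if_neg h.not_gt]
      · left
        refine ⟨_, mem_signPatterns.2 ⟨x, ⟨hx, h⟩, hxs.2, rfl⟩, ?_⟩
        rw [Finset.filter_insert, if_pos h]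
    · rintro (⟨Q, hQ, rfl⟩ | hQ)
      · obtain ⟨x, ⟨hx, h⟩, hxs, rfl⟩ := mem_signPatterns.1 hQ
        refine mem_signPatterns.2 ⟨x, hx, Finset.forall_mem_insert _ _ _ |>.2 ⟨ne_of_gt h, hxs⟩, ?_⟩
        rw [Finset.filter_insert, if_pos (show 0 < f i x from h)]
      · obtain ⟨x, ⟨hx, h⟩, hxs, rfl⟩ := mem_signPatterns.1 hQ
        refine mem_signPatterns.2 ⟨x, hx, Finset.forall_mem_insert _ _ _ |>.2 ⟨ne_of_lt h, hxs⟩, ?_⟩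
        rw [Finset.filter_insert, if_neg (not_lt_of_gt h)]
  have h2 : A ∪ B = signPatterns f X s := by
    ext P
    constructor
    · rintro (h | h) <;> obtain ⟨x, ⟨hx, -⟩, hxs, rfl⟩ := mem_signPatterns.1 h <;>
        exact mem_signPatterns.2 ⟨x, hx, hxs, rfl⟩
    · intro hP
      obtain ⟨x, hx, hxs, rfl⟩ := mem_signPatterns.1 hP
      rcases lt_trichotomy (f i x) 0 with h | h | h
      · exact Or.inr (mem_signPatterns.2 ⟨x, ⟨hx, h⟩, hxs, rfl⟩)
      · obtain ⟨z, hz, hz0, hzs⟩ := exists_perturbation hX hx hy hxs h hy0 1 one_ne_zero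
        refine Or.inl (mem_signPatterns.2 ⟨z, ⟨hz, by simpa using hz0⟩, fun j hj => (hzs j hj).1,
          Finset.filter_congr fun j hj => (hzs j hj).2⟩)
      · exact Or.inl (mem_signPatterns.2 ⟨x, ⟨hx, h⟩, hxs, rfl⟩)
  have h3 : A ∩ B = signPatterns f (X ∩ {x | f i x = 0}) s := by
    ext P
    constructor
    · rintro ⟨hA, hB⟩
      obtain ⟨a, ⟨ha, hap⟩, has, rfl⟩ := mem_signPatterns.1 hA
      obtain ⟨b, ⟨hb, hbn⟩, hbs, hab⟩ := mem_signPatterns.1 hB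
      simp only [Set.mem_ofPred_eq] at hap hbn
      have hiff : ∀ j ∈ s, 0 < f j a ↔ 0 < f j b := by
        intro j hj
        have := congrArg (j ∈ ·) hab
        simp only [Finset.mem_filter, hj, true_and, eq_iff_iff] at this
        exact this.symm
      have hd : 0 < f i a - f i b := by linarith
      -- The parameter at which the segment from `a` to `b` crosses the zero locus of `f i`; by
      -- convexity the common signs at `a` and `b` persist there.
      set t : ℝ := f i a / (f i a - f i b) with ht
      have ht0 : 0 < t := by positivity
      have ht1 : 0 < 1 - t := by
        have : 1 - t = (- f i b) / (f i a - f i b) := by rw [ht]; field_simp; ring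
        rw [this]
        exact div_pos (by linarith) hd
      have hval : ∀ j, f j (AffineMap.lineMap a b t) = (1 - t) * f j a + t * f j b := by
        intro j
        rw [AffineMap.apply_lineMap, AffineMap.lineMap_apply]
        simp only [vsub_eq_sub, smul_eq_mul, vadd_eq_add]
        ring
      have hpos : ∀ j ∈ s, 0 < f j a → 0 < f j (AffineMap.lineMap a b t) := by
        intro j hj h
        have h' := (hiff j hj).1 h
        rw [hval]; positivity
      have hneg : ∀ j ∈ s, ¬ 0 < f j a → f j (AffineMap.lineMap a b t) < 0 := by
        intro j hj h
        have hb' : f j b < 0 := lt_of_le_of_ne (not_lt.1 (mt (hiff j hj).2 h)) (hbs j hj)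
        have ha' : f j a < 0 := lt_of_le_of_ne (not_lt.1 h) (has j hj)
        rw [hval]
        nlinarith
      refine mem_signPatterns.2 ⟨_, ⟨hX a ha b hb t, ?_⟩, ?_, ?_⟩
      · simp only [Set.mem_ofPred_eq]
        rw [hval, ht]; field_simp; ring
      · intro j hj
        by_cases h : 0 < f j a
        · exact (hpos j hj h).ne'
        · exact (hneg j hj h).ne
      · refine Finset.filter_congr fun j hj => ⟨fun h => ?_, hpos j hj⟩
        by_contra h'
        exact (hneg j hj h').not_gt h
    · intro hP
      obtain ⟨x, ⟨hx, hx0⟩, hxs, rfl⟩ := mem_signPatterns.1 hP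
      constructor
      · obtain ⟨z, hz, hz0, hzs⟩ := exists_perturbation hX hx hy hxs hx0 hy0 1 one_ne_zero
        exact mem_signPatterns.2 ⟨z, ⟨hz, by simpa using hz0⟩, fun j hj => (hzs j hj).1,
          Finset.filter_congr fun j hj => (hzs j hj).2⟩
      · obtain ⟨z, hz, hz0, hzs⟩ := exists_perturbation hX hx hy hxs hx0 hy0 (-1) (by norm_num)
        exact mem_signPatterns.2 ⟨z, ⟨hz, by simpa using hz0⟩, fun j hj => (hzs j hj).1,
          Finset.filter_congr fun j hj => (hzs j hj).2⟩
  unfold numRegions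
  rw [h1, Set.ncard_union_eq ?_ (finite_signPatterns.image _) finite_signPatterns,
    Set.InjOn.ncard_image, ← h2, ← h3,
    Set.ncard_union_add_ncard_inter _ _ finite_signPatterns finite_signPatterns]
  · intro P hP Q hQ hPQ
    have := congrArg (Finset.erase · i) hPQ
    simpa [Finset.erase_insert (hnot hP), Finset.erase_insert (hnot hQ)] using this
  · rw [Set.disjoint_left]
    rintro _ ⟨Q, -, rfl⟩ hB
    exact hnot hB (Finset.mem_insert_self _ _)

theorem numRegions_eq_zero {i : ι} (hi : i ∈ s) (h : ∀ x ∈ X, f i x = 0) :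
    numRegions f X s = 0 := by
  unfold numRegions
  rw [Set.ncard_eq_zero finite_signPatterns, Set.eq_empty_iff_forall_notMem]
  intro P hP
  obtain ⟨x, hx, hxs, -⟩ := mem_signPatterns.1 hP
  exact hxs i hi (h x hx)

theorem numRegions_empty_set : numRegions f ∅ s = 0 := by
  simp [numRegions, signPatterns]

theorem numRegions_le_one (hX : X.Subsingleton) : numRegions f X s ≤ 1 := by
  have hsub : (signPatterns f X s).Subsingleton := (hX.anti fun _ h => h.1).image _
  have := (finite_signPatterns (f := f) (X := X) (s := s)).to_subtype
  exact Set.ncard_le_one_iff_subsingleton.2 hsub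

theorem numRegions_singleton {x : E} (h : ∀ i ∈ s, f i x ≠ 0) : numRegions f {x} s = 1 := by
  unfold numRegions signPatterns
  have : {y | y ∈ ({x} : Set E) ∧ ∀ i ∈ s, f i y ≠ 0} = {x} := by
    ext y
    simp only [Set.mem_singleton_iff, Set.mem_ofPred_eq, and_iff_left_iff_imp]
    rintro rfl
    exact h
  rw [this, Set.image_singleton, Set.ncard_singleton]

theorem numRegions_empty_index (hX : X.Nonempty) : numRegions f X ∅ = 1 := by
  unfold numRegions signPatterns
  simp [Set.Nonempty.image_const hX]

/-- On the zero locus of `f j` the function `f i` vanishes identically, so the restricted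
arrangement has no admissible point and adds no region. -/
theorem numRegions_insert_of_zeros_subset [DecidableEq ι] (hX : IsFlat X) {i j : ι} (hi : i ∈ s)
    (h : ∀ x ∈ X, f j x = 0 → f i x = 0) :
    numRegions f X (insert j s) = numRegions f X s := by
  by_cases hj : j ∈ s
  · rw [Finset.insert_eq_of_mem hj]
  by_cases hne : ∃ y ∈ X, f j y ≠ 0
  · rw [numRegions_insert hX hj hne,
      numRegions_eq_zero (X := X ∩ {x | f j x = 0}) hi fun x hx => h x hx.1 hx.2, add_zero]
  · push Not at hne
    rw [numRegions_eq_zero (Finset.mem_insert_self j s) hne,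
      numRegions_eq_zero hi fun x hx => h x hx (hne x hx)]

theorem numRegions_union_of_zeros_subset [DecidableEq ι] (hX : IsFlat X) (t : Finset ι)
    (h : ∀ j ∈ t, ∃ i ∈ s, ∀ x ∈ X, f j x = 0 → f i x = 0) :
    numRegions f X (s ∪ t) = numRegions f X s := by
  induction t using Finset.induction_on with
  | empty => simp
  | insert j t _ ih =>
    obtain ⟨i, hi, hij⟩ := h j (Finset.mem_insert_self _ _)
    rw [Finset.union_insert, numRegions_insert_of_zeros_subset hX (Finset.mem_union_left t hi) hij]
    exact ih fun j' hj' => h j' (Finset.mem_insert_of_mem hj')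

/-- Each zero locus that is at most a point adds at most one region. The alternative of identical
vanishing covers coinciding bisectors; it leaves no region at all. -/
theorem numRegions_line_le (hX : IsFlat X)
    (hL : ∀ i ∈ s, (∀ x ∈ X, f i x = 0) ∨ (X ∩ {x | f i x = 0}).Subsingleton) :
    numRegions f X s ≤ 1 + s.card := by
  classical
  induction s using Finset.induction_on with
  | empty =>
    rcases X.eq_empty_or_nonempty with rfl | h
    · simp [numRegions_empty_set]
    · simp [numRegions_empty_index h]
  | insert i s hi ih =>
    by_cases hne : ∃ y ∈ X, f i y ≠ 0
    · have h1 := ih fun j hj => hL j (Finset.mem_insert_of_mem hj)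
      have h2 : (X ∩ {x | f i x = 0}).Subsingleton := by
        refine (hL i (Finset.mem_insert_self _ _)).resolve_left ?_
        push Not
        exact hne
      have h3 := numRegions_le_one (f := f) (s := s) h2
      rw [numRegions_insert hX hi hne, Finset.card_insert_of_notMem hi]
      omega
    · push Not at hne
      rw [numRegions_eq_zero (Finset.mem_insert_self i s) hne]
      omega

open Classical in
theorem numRegions_line_eq (hX : IsFlat X) (hne : X.Nonempty)
    (hnz : ∀ i ∈ s, ∃ y ∈ X, f i y ≠ 0)
    (hL : ∀ i ∈ s, (X ∩ {x | f i x = 0}).Subsingleton)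
    (hd : ∀ i ∈ s, ∀ j ∈ s, i ≠ j → ∀ x ∈ X, f i x = 0 → f j x ≠ 0) :
    numRegions f X s = 1 + (s.filter fun i => ∃ x ∈ X, f i x = 0).card := by
  induction s using Finset.induction_on with
  | empty => simp [numRegions_empty_index hne]
  | insert i s hi ih =>
    rw [numRegions_insert hX hi (hnz i (Finset.mem_insert_self _ _)),
      ih (fun j hj => hnz j (Finset.mem_insert_of_mem hj))
        (fun j hj => hL j (Finset.mem_insert_of_mem hj))
        (fun j hj k hk => hd j (Finset.mem_insert_of_mem hj) k (Finset.mem_insert_of_mem hk)),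
      Finset.filter_insert]
    split_ifs with h
    · obtain ⟨x, hx, hx0⟩ := h
      have : X ∩ {x | f i x = 0} = {x} :=
        (hL i (Finset.mem_insert_self _ _)).eq_singleton_of_mem ⟨hx, hx0⟩
      rw [this, numRegions_singleton, Finset.card_insert_of_notMem (by simp [hi]), add_assoc]
      intro j hj
      exact hd i (Finset.mem_insert_self _ _) j (Finset.mem_insert_of_mem hj)
        (by rintro rfl; exact hi hj) x hx hx0
    · have : X ∩ {x | f i x = 0} = ∅ := by
        rw [Set.eq_empty_iff_forall_notMem]
        rintro x ⟨hx, hx0⟩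
        exact h ⟨x, hx, hx0⟩
      rw [this, numRegions_empty_set, add_zero]

end Arrangement

/-! ### Orderings as regions of the bisector arrangement -/

theorem mem_bisector {p q x : Plane} : x ∈ bisector s(p, q) ↔ dist x p = dist x q :=
  AffineSubspace.mem_perpBisector_iff_dist_eq

theorem mk_mem_pairs {S : Finset Plane} {p q : Plane} :
    s(p, q) ∈ pairs S ↔ p ≠ q ∧ p ∈ S ∧ q ∈ S := by
  simp [pairs]

theorem pairs_mono {S T : Finset Plane} (h : S ⊆ T) : pairs S ⊆ pairs T :=
  fun _ he => ⟨he.1, fun p hp => h (he.2 p hp)⟩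

open Classical in
/-- The unordered pairs of distinct points of `S`, as a finite set. -/
noncomputable def pairsFinset (S : Finset Plane) : Finset (Sym2 Plane) :=
  S.sym2.filter fun e => ¬ e.IsDiag

theorem mem_pairsFinset {S : Finset Plane} {e : Sym2 Plane} : e ∈ pairsFinset S ↔ e ∈ pairs S := by
  simp only [pairsFinset, Finset.mem_filter, Finset.mem_sym2_iff, pairs, Set.mem_ofPred_eq]
  tauto

theorem card_pairsFinset (S : Finset Plane) : (pairsFinset S).card = S.card.choose 2 := by
  classical
  rw [← Sym2.card_image_offDiag]
  congr 1
  ext e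
  rw [mem_pairsFinset]
  induction e with | _ a b
  simp only [mk_mem_pairs, Finset.mem_image, Finset.mem_offDiag, Prod.exists,
    Function.uncurry_apply_pair]
  constructor
  · rintro ⟨h, ha, hb⟩
    exact ⟨a, b, ⟨ha, hb, h⟩, rfl⟩
  · rintro ⟨c, d, ⟨hc, hd, h⟩, hcd⟩
    rcases Sym2.eq_iff.1 hcd with ⟨rfl, rfl⟩ | ⟨rfl, rfl⟩
    · exact ⟨h, hc, hd⟩
    · exact ⟨h.symm, hd, hc⟩

/-- The affine function whose value at `x` is the difference of the squared distances from `x` to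
`p` and to `q`. -/
noncomputable def distDiff (p q : Plane) : Plane →ᵃ[ℝ] ℝ :=
  ((2 : ℝ) • innerSL ℝ (q - p)).toLinearMap.toAffineMap +
    AffineMap.const ℝ Plane (‖p‖ ^ 2 - ‖q‖ ^ 2)

theorem distDiff_apply (p q x : Plane) : distDiff p q x = dist x p ^ 2 - dist x q ^ 2 := by
  rw [dist_eq_norm, dist_eq_norm, norm_sub_sq_real, norm_sub_sq_real]
  simp [distDiff, real_inner_comm x]
  ring

theorem distDiff_swap (p q x : Plane) : distDiff q p x = - distDiff p q x := by
  rw [distDiff_apply, distDiff_apply]; ring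

theorem distDiff_pos_iff (p q x : Plane) : 0 < distDiff p q x ↔ dist x q < dist x p := by
  rw [distDiff_apply, sub_pos, sq_lt_sq₀ dist_nonneg dist_nonneg]

theorem distDiff_eq_zero_iff (p q x : Plane) : distDiff p q x = 0 ↔ dist x p = dist x q := by
  rw [distDiff_apply, sub_eq_zero, sq_eq_sq₀ dist_nonneg dist_nonneg]

/-- An affine function whose zero locus is the bisector of `e`. -/
noncomputable def bisectorMap (e : Sym2 Plane) : Plane →ᵃ[ℝ] ℝ := distDiff e.out.1 e.out.2

theorem bisectorMap_mk (p q : Plane) :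
    bisectorMap s(p, q) = distDiff p q ∨ bisectorMap s(p, q) = distDiff q p := by
  have h : s(s(p, q).out.1, s(p, q).out.2) = s(p, q) := Quot.out_eq _
  rcases Sym2.eq_iff.1 h with ⟨h1, h2⟩ | ⟨h1, h2⟩
  · left; rw [bisectorMap, h1, h2]
  · right; rw [bisectorMap, h1, h2]

theorem bisectorMap_eq_zero_iff (e : Sym2 Plane) (x : Plane) :
    bisectorMap e x = 0 ↔ x ∈ bisector e := by
  induction e with | _ p q
  rw [mem_bisector]
  rcases bisectorMap_mk p q with h | h <;> rw [h, distDiff_eq_zero_iff]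
  exact eq_comm

theorem setOf_bisectorMap_eq_zero (e : Sym2 Plane) :
    {x | bisectorMap e x = 0} = (bisector e : Set Plane) := by
  ext x
  exact bisectorMap_eq_zero_iff e x

theorem isFlat_bisector (e : Sym2 Plane) : IsFlat (bisector e : Set Plane) :=
  fun _ hx _ hy t => AffineMap.lineMap_mem t hx hy

theorem injOn_dist_iff {S : Finset Plane} {x : Plane} :
    Set.InjOn (fun p => dist x p) (S : Set Plane) ↔ ∀ e ∈ pairsFinset S, bisectorMap e x ≠ 0 := by
  constructor
  · intro h e he
    rw [mem_pairsFinset] at he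
    rw [Ne, bisectorMap_eq_zero_iff]
    induction e with | _ p q
    rw [mk_mem_pairs] at he
    rw [mem_bisector]
    exact fun hx => he.1 (h he.2.1 he.2.2 hx)
  · intro h p hp q hq hpq
    by_contra hne
    exact h s(p, q) (mem_pairsFinset.2 (mk_mem_pairs.2 ⟨hne, hp, hq⟩))
      ((bisectorMap_eq_zero_iff _ _).2 (mem_bisector.2 hpq))

theorem same_order_iff {S : Finset Plane} {x y : Plane}
    (hx : ∀ e ∈ pairsFinset S, bisectorMap e x ≠ 0)
    (hy : ∀ e ∈ pairsFinset S, bisectorMap e y ≠ 0) :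
    (fun p q : S => dist x (p : Plane) < dist x (q : Plane)) =
        (fun p q : S => dist y (p : Plane) < dist y (q : Plane)) ↔
      (pairsFinset S).filter (fun e => 0 < bisectorMap e x) =
        (pairsFinset S).filter (fun e => 0 < bisectorMap e y) := by
  rw [Finset.filter_inj']
  constructor
  · intro h e he
    rw [mem_pairsFinset] at he
    induction e with | _ p q
    rw [mk_mem_pairs] at he
    have h1 := congrFun (congrFun h ⟨p, he.2.1⟩) ⟨q, he.2.2⟩
    have h2 := congrFun (congrFun h ⟨q, he.2.2⟩) ⟨p, he.2.1⟩
    simp only [eq_iff_iff] at h1 h2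
    rcases bisectorMap_mk p q with h' | h' <;> rw [h', distDiff_pos_iff, distDiff_pos_iff]
    · exact h2
    · exact h1
  · intro h
    funext ⟨p, hp⟩ ⟨q, hq⟩
    rw [eq_iff_iff]
    by_cases hpq : p = q
    · subst hpq; simp
    have hmem : s(p, q) ∈ pairsFinset S := mem_pairsFinset.2 (mk_mem_pairs.2 ⟨hpq, hp, hq⟩)
    have h1 := h hmem
    have hx1 := hx _ hmem
    have hy1 := hy _ hmem
    rcases bisectorMap_mk p q with h' | h' <;> rw [h'] at h1 hx1 hy1
    -- Here the chosen representative has the opposite orientation, so the signs are negated;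
    -- nonvanishing turns the negation into a strict inequality.
    · rw [← distDiff_pos_iff, ← distDiff_pos_iff, distDiff_swap p q x, distDiff_swap p q y,
        neg_pos, neg_pos, ← not_iff_not, not_lt, not_lt, hx1.symm.le_iff_lt, hy1.symm.le_iff_lt]
      exact h1
    · rw [← distDiff_pos_iff, ← distDiff_pos_iff]
      exact h1

/-- Both maps induce the same equivalence relation on `G`, and each image is its set of classes. -/
theorem ncard_image_eq_ncard_image {α β γ : Type*} {G : Set α} {φ : α → β} {ψ : α → γ}
    (h : ∀ x ∈ G, ∀ y ∈ G, φ x = φ y ↔ ψ x = ψ y) : (φ '' G).ncard = (ψ '' G).ncard := by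
  refine Set.ncard_congr (fun b hb => ψ hb.choose) ?_ ?_ ?_
  · intro b hb
    exact ⟨_, hb.choose_spec.1, rfl⟩
  · intro b c hb hc hbc
    rw [← hb.choose_spec.2, ← hc.choose_spec.2]
    exact (h _ hb.choose_spec.1 _ hc.choose_spec.1).2 hbc
  · rintro _ ⟨x, hx, rfl⟩
    have hφ : φ x ∈ φ '' G := ⟨x, hx, rfl⟩
    exact ⟨φ x, hφ, (h _ hφ.choose_spec.1 _ hx).1 hφ.choose_spec.2⟩

theorem numOrderings_eq_numRegions (S : Finset Plane) :
    numOrderings S = numRegions bisectorMap Set.univ (pairsFinset S) := by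
  have h : orderings S = (fun x => fun p q : S => dist x (p : Plane) < dist x (q : Plane)) ''
      {x | x ∈ Set.univ ∧ ∀ e ∈ pairsFinset S, bisectorMap e x ≠ 0} := by
    ext r
    simp only [orderings, Set.mem_ofPred_eq, Set.mem_image, Set.mem_univ, true_and,
      injOn_dist_iff, eq_comm]
  rw [numOrderings, numRegions, signPatterns, h]
  exact ncard_image_eq_ncard_image fun x hx y hy => same_order_iff hx.2 hy.2

open Classical in
theorem pairsFinset_insert {S : Finset Plane} {p : Plane} (hp : p ∉ S) :
    pairsFinset (insert p S) = pairsFinset S ∪ S.image fun q => s(p, q) := by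
  ext e
  rw [Finset.mem_union, mem_pairsFinset, mem_pairsFinset, Finset.mem_image]
  induction e with | _ a b
  simp only [mk_mem_pairs, Finset.mem_insert, Sym2.eq_iff]
  constructor
  · rintro ⟨hab, rfl | ha, rfl | hb⟩
    · exact absurd rfl hab
    · exact Or.inr ⟨b, hb, Or.inl ⟨rfl, rfl⟩⟩
    · exact Or.inr ⟨a, ha, Or.inr ⟨rfl, rfl⟩⟩
    · exact Or.inl ⟨hab, ha, hb⟩
  · rintro (⟨hab, ha, hb⟩ | ⟨q, hq, ⟨rfl, rfl⟩ | ⟨rfl, rfl⟩⟩)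
    · exact ⟨hab, Or.inr ha, Or.inr hb⟩
    · exact ⟨by rintro rfl; exact hp hq, Or.inl rfl, Or.inr hq⟩
    · exact ⟨by rintro rfl; exact hp hq, Or.inr hq, Or.inl rfl⟩

/-- The bisectors of `p` with the points of `S` are inserted one by one. Those inserted earlier
create no cuts on the current one beyond the cuts made by bisectors of `S`, so the summands do not
depend on the order. -/
theorem numOrderings_insert [DecidableEq Plane] {S : Finset Plane} {p : Plane} (hp : p ∉ S) :
    numOrderings (insert p S) = numOrderings S +
      ∑ q ∈ S, numRegions bisectorMap (bisector s(p, q) : Set Plane) (pairsFinset S) := by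
  classical
  have key : ∀ T ⊆ S, numRegions bisectorMap Set.univ (pairsFinset S ∪ T.image fun q => s(p, q)) =
      numRegions bisectorMap Set.univ (pairsFinset S) +
        ∑ q ∈ T, numRegions bisectorMap (bisector s(p, q) : Set Plane) (pairsFinset S) := by
    intro T
    induction T using Finset.induction_on with
    | empty => simp
    | insert q T hq ih =>
      intro hTS
      rw [Finset.insert_subset_iff] at hTS
      have hpq : p ≠ q := by rintro rfl; exact hp hTS.1
      have hnot : s(p, q) ∉ pairsFinset S ∪ T.image fun q => s(p, q) := by
        rw [Finset.mem_union, mem_pairsFinset, mk_mem_pairs, Finset.mem_image]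
        rintro (h | ⟨q', hq', h⟩)
        · exact hp h.2.1
        · rw [Sym2.congr_right] at h
          exact hq (h ▸ hq')
      have hne : ∃ y ∈ (Set.univ : Set Plane), bisectorMap s(p, q) y ≠ 0 := by
        refine ⟨p, Set.mem_univ _, ?_⟩
        rw [Ne, bisectorMap_eq_zero_iff, mem_bisector, dist_self]
        exact (dist_pos.2 hpq).ne
      rw [Finset.image_insert, Finset.union_insert,
        numRegions_insert (fun _ _ _ _ _ => Set.mem_univ _) hnot hne, ih hTS.2, Set.univ_inter, setOf_bisectorMap_eq_zero,
        numRegions_union_of_zeros_subset (isFlat_bisector _), Finset.sum_insert hq]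
      · ring
      -- A point of the bisector of `p, q` equidistant from `p, q'` is also equidistant from `q,
      -- q'`, and the latter pair lies in `S`.
      · intro j hj
        obtain ⟨q', hq', rfl⟩ := Finset.mem_image.1 hj
        refine ⟨s(q, q'), mem_pairsFinset.2 (mk_mem_pairs.2
          ⟨by rintro rfl; exact hq hq', hTS.1, hTS.2 hq'⟩), ?_⟩
        intro x hx
        rw [SetLike.mem_coe, mem_bisector] at hx
        rw [bisectorMap_eq_zero_iff, bisectorMap_eq_zero_iff, mem_bisector, mem_bisector, hx]
        exact id
  rw [numOrderings_eq_numRegions, numOrderings_eq_numRegions]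
  convert key S subset_rfl using 2
  convert pairsFinset_insert hp

/-! ### Bisectors as lines: parallelism, intersections and cuts -/

theorem finrank_direction_bisector {e : Sym2 Plane} (he : ¬ e.IsDiag) :
    Module.finrank ℝ (bisector e).direction = 1 := by
  induction e with | _ p q
  have : Fact (Module.finrank ℝ Plane = 1 + 1) := ⟨by simp⟩
  have h : (bisector s(p, q)).direction = (ℝ ∙ (q - p))ᗮ :=
    AffineSubspace.direction_perpBisector p q
  rw [h]
  exact Submodule.finrank_orthogonal_span_singleton (sub_ne_zero.2 (Ne.symm (by simpa using he)))

theorem bisector_nonempty (e : Sym2 Plane) : (bisector e : Set Plane).Nonempty := by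
  induction e with | _ p q
  exact AffineSubspace.perpBisector_nonempty

theorem bisector_parallel_iff {e f : Sym2 Plane} :
    (bisector e).Parallel (bisector f) ↔ (bisector e).direction = (bisector f).direction := by
  rw [AffineSubspace.parallel_iff_direction_eq_and_eq_bot_iff_eq_bot, and_iff_left_iff_imp]
  have hb (e) : bisector e ≠ ⊥ := (AffineSubspace.nonempty_iff_ne_bot _).1 (bisector_nonempty e)
  simp [hb]

theorem bisector_eq_of_le {e f : Sym2 Plane} (he : ¬ e.IsDiag) (hf : ¬ f.IsDiag)
    (h : (bisector e : Set Plane) ⊆ bisector f) : bisector e = bisector f := by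
  have hle : bisector e ≤ bisector f := h
  refine AffineSubspace.ext_of_direction_eq ?_ ?_
  · refine Submodule.eq_of_le_of_finrank_eq (AffineSubspace.direction_le hle) ?_
    rw [finrank_direction_bisector he, finrank_direction_bisector hf]
  · obtain ⟨x, hx⟩ := bisector_nonempty e
    exact ⟨x, hx, h hx⟩

theorem bisector_subset_or_subsingleton {e : Sym2 Plane} (he : ¬ e.IsDiag) (f : Sym2 Plane) :
    (bisector e : Set Plane) ⊆ bisector f ∨
      ((bisector e : Set Plane) ∩ bisector f).Subsingleton := by
  rw [or_iff_not_imp_right, Set.not_subsingleton_iff]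
  rintro ⟨x, ⟨hx, hxf⟩, y, ⟨hy, hyf⟩, hxy⟩ z hz
  have hv : (⟨y -ᵥ x, AffineSubspace.vsub_mem_direction hy hx⟩ : (bisector e).direction) ≠ 0 := by
    rw [Ne, Submodule.mk_eq_zero, vsub_eq_zero_iff_eq]
    exact hxy.symm
  obtain ⟨c, hc⟩ := exists_smul_eq_of_finrank_eq_one (finrank_direction_bisector he) hv
    ⟨z -ᵥ x, AffineSubspace.vsub_mem_direction hz hx⟩
  have hc' : c • (y -ᵥ x) = z -ᵥ x := congrArg Subtype.val hc
  have : z = AffineMap.lineMap x y c := by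
    rw [AffineMap.lineMap_apply, hc', vsub_vadd]
  rw [this]
  exact AffineMap.lineMap_mem c hxf hyf

theorem inter_bisector_subsingleton {e f : Sym2 Plane} (he : ¬ e.IsDiag) (hf : ¬ f.IsDiag)
    (h : bisector e ≠ bisector f) : ((bisector e : Set Plane) ∩ bisector f).Subsingleton :=
  (bisector_subset_or_subsingleton he f).resolve_left fun h' => h (bisector_eq_of_le he hf h')

theorem exists_mem_inter_of_not_parallel {e f : Sym2 Plane} (he : ¬ e.IsDiag) (hf : ¬ f.IsDiag)
    (h : ¬ (bisector e).Parallel (bisector f)) : ∃ x ∈ bisector e, x ∈ bisector f := by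
  have hdir := mt bisector_parallel_iff.2 h
  refine AffineSubspace.inter_nonempty_of_nonempty_of_sup_direction_eq_top (bisector_nonempty e)
    (bisector_nonempty f) ?_
  have h1 := finrank_direction_bisector he
  have h2 := finrank_direction_bisector hf
  have hinf : Module.finrank ℝ ↥((bisector e).direction ⊓ (bisector f).direction) < 1 := by
    by_contra! hle
    have e1 : (bisector e).direction ⊓ (bisector f).direction = (bisector e).direction :=
      Submodule.eq_of_le_of_finrank_le inf_le_left (by omega)
    have e2 : (bisector e).direction ⊓ (bisector f).direction = (bisector f).direction :=
      Submodule.eq_of_le_of_finrank_le inf_le_right (by omega)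
    exact hdir (e1.symm.trans e2)
  have hsum := Submodule.finrank_sup_add_finrank_inf_eq (bisector e).direction
    (bisector f).direction
  have h3 : Module.finrank ℝ Plane = 2 := by simp
  refine Submodule.eq_top_of_finrank_eq ?_
  have h4 := Submodule.finrank_le ((bisector e).direction ⊔ (bisector f).direction)
  omega

theorem bisector_parallel_mk_iff {p q a b : Plane} :
    (bisector s(p, q)).Parallel (bisector s(a, b)) ↔ (ℝ ∙ (q - p)) = ℝ ∙ (b - a) := by
  rw [bisector_parallel_iff]
  have h (p q : Plane) : (bisector s(p, q)).direction = (ℝ ∙ (q - p))ᗮ :=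
    AffineSubspace.direction_perpBisector p q
  rw [h, h]
  constructor
  · intro h'
    rw [← Submodule.orthogonal_orthogonal (ℝ ∙ (q - p)), h', Submodule.orthogonal_orthogonal]
  · intro h'
    rw [h']

theorem bisector_parallel_of_collinear {S : Finset Plane} (hS : Collinear ℝ (S : Set Plane))
    {e f : Sym2 Plane} (he : e ∈ pairs S) (hf : f ∈ pairs S) :
    (bisector e).Parallel (bisector f) := by
  obtain ⟨p₀, v, hv⟩ := (collinear_iff_exists_forall_eq_smul_vadd _).1 hS
  have key (a b : Plane) (hab : s(a, b) ∈ pairs S) : (ℝ ∙ (b - a)) = ℝ ∙ v := by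
    rw [mk_mem_pairs] at hab
    obtain ⟨hne, ha, hb⟩ := hab
    obtain ⟨r, rfl⟩ := hv a ha
    obtain ⟨t, rfl⟩ := hv b hb
    have : t - r ≠ 0 := by
      rintro h
      rw [sub_eq_zero.1 h] at hne
      exact hne rfl
    rw [vadd_eq_add, vadd_eq_add, add_sub_add_right_eq_sub, ← sub_smul]
    exact Submodule.span_singleton_smul_eq (IsUnit.mk0 _ this) v
  induction e with | _ p q
  induction f with | _ a b
  rw [bisector_parallel_mk_iff, key p q he, key a b hf]

theorem numRegions_bisector_le {e : Sym2 Plane} (he : ¬ e.IsDiag) (S : Finset Plane) :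
    numRegions bisectorMap (bisector e : Set Plane) (pairsFinset S) ≤ 1 + S.card.choose 2 := by
  rw [← card_pairsFinset]
  refine numRegions_line_le (isFlat_bisector e) fun f _ => ?_
  rw [setOf_bisectorMap_eq_zero]
  simp only [bisectorMap_eq_zero_iff]
  exact bisector_subset_or_subsingleton he f

open Classical in
theorem numRegions_bisector_eq {e : Sym2 Plane} (he : ¬ e.IsDiag) {S : Finset Plane}
    (hne : ∀ f ∈ pairs S, bisector e ≠ bisector f)
    (hd : ∀ f ∈ pairs S, ∀ g ∈ pairs S, f ≠ g → ∀ x ∈ bisector e, x ∈ bisector f →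
      x ∉ bisector g) :
    numRegions bisectorMap (bisector e : Set Plane) (pairsFinset S) =
      1 + ((pairsFinset S).filter fun f => ∃ x ∈ bisector e, x ∈ bisector f).card := by
  rw [numRegions_line_eq (isFlat_bisector e) (bisector_nonempty e)]
  · simp only [bisectorMap_eq_zero_iff, SetLike.mem_coe]
  · intro f hf
    rw [mem_pairsFinset] at hf
    by_contra! h
    refine hne f hf (bisector_eq_of_le he hf.1 fun x hx => ?_)
    exact (bisectorMap_eq_zero_iff f x).1 (h x hx)
  · intro f hf
    rw [mem_pairsFinset] at hf
    rw [setOf_bisectorMap_eq_zero]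
    exact inter_bisector_subsingleton he hf.1 (hne f hf)
  · intro f hf g hg hfg x hx hxf
    rw [Ne, bisectorMap_eq_zero_iff]
    exact hd f (mem_pairsFinset.1 hf) g (mem_pairsFinset.1 hg) hfg x hx
      ((bisectorMap_eq_zero_iff _ _).1 hxf)

/-! ### Closed forms and the Stirling recurrence -/

/-- The number of orderings of `n` points in general position. -/
def generalCount : ℕ → ℕ
  | 0 => 1
  | n + 1 => generalCount n + n * (1 + n.choose 2)

/-- The number of orderings lost when `k` points of a set in general position are made
collinear. -/
def collinearLoss : ℕ → ℕ
  | 0 => 0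
  | k + 1 => collinearLoss k + k * k.choose 2

theorem cast_generalCount (n : ℕ) :
    (generalCount n : ℚ) = (3 * n ^ 4 - 10 * n ^ 3 + 21 * n ^ 2 - 14 * n + 24) / 24 := by
  induction n with
  | zero => simp [generalCount]
  | succ n ih =>
    rw [generalCount]
    push_cast
    rw [ih, Nat.cast_choose_two]
    ring

theorem cast_collinearLoss (k : ℕ) :
    (collinearLoss k : ℚ) = (3 * k ^ 4 - 10 * k ^ 3 + 9 * k ^ 2 - 2 * k) / 24 := by
  induction k with
  | zero => simp [collinearLoss]
  | succ k ih =>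
    rw [collinearLoss]
    push_cast
    rw [ih, Nat.cast_choose_two]
    ring

/-- The recurrence of the Stirling numbers reduces to that of `collinearLoss` because `s(n, n-1) =
n.choose 2`. -/
theorem collinearLoss_add_two (k : ℕ) : collinearLoss (k + 2) = Nat.stirlingFirst (k + 2) k := by
  induction k with
  | zero => simp [collinearLoss]
  | succ k ih =>
    rw [collinearLoss, ih, Nat.stirlingFirst_succ_succ, Nat.stirlingFirst_succ_self_left]
    ring

theorem stirlingOne_sub_two (k : ℕ) : stirlingOne k ((k : ℤ) - 2) = collinearLoss k := by
  match k with
  | 0 => simp [stirlingOne, collinearLoss]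
  | 1 => simp [stirlingOne, collinearLoss]
  | k + 2 => simp [stirlingOne, collinearLoss_add_two]

/-! ### The maximum number of orderings -/

theorem numOrderings_empty : numOrderings ∅ = 1 := by
  rw [numOrderings_eq_numRegions, show pairsFinset ∅ = ∅ by simp [pairsFinset],
    numRegions_empty_index Set.univ_nonempty]

theorem numOrderings_le (S : Finset Plane) : numOrderings S ≤ generalCount S.card := by
  classical
  induction S using Finset.induction_on with
  | empty => simp [numOrderings_empty, generalCount]
  | insert p S hp ih =>
    rw [numOrderings_insert hp, Finset.card_insert_of_notMem hp, generalCount]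
    refine add_le_add ih ?_
    rw [← smul_eq_mul, ← Finset.sum_const]
    refine Finset.sum_le_sum fun q hq => numRegions_bisector_le ?_ S
    rw [Sym2.mk_isDiag_iff]
    rintro rfl
    exact hp hq

-- Such a `p` lies on the affine subspace through `q` spanned by `b - a`, which has dimension at
-- most one.
open MeasureTheory in
theorem volume_parallel_bisector (q : Plane) {f : Sym2 Plane} :
    volume {p : Plane | p ≠ q ∧ (bisector s(p, q)).Parallel (bisector f)} = 0 := by
  induction f with | _ a b
  have hne : AffineSubspace.mk' q (ℝ ∙ (b - a)) ≠ ⊤ := by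
    intro h
    have h1 := congrArg AffineSubspace.direction h
    rw [AffineSubspace.direction_mk', AffineSubspace.direction_top] at h1
    have h2 := finrank_span_le_card (R := ℝ) {b - a}
    rw [h1, finrank_top] at h2
    simp at h2
  refine measure_mono_null ?_ (Measure.addHaar_affineSubspace volume _ hne)
  rintro p ⟨-, h⟩
  rw [bisector_parallel_mk_iff] at h
  rw [SetLike.mem_coe, AffineSubspace.mem_mk', ← h, vsub_eq_sub, ← neg_sub q p]
  exact Submodule.neg_mem _ (Submodule.mem_span_singleton_self _)

-- Such a `p` lies on the circle through `q` centred at the only possible `x`.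
open MeasureTheory in
theorem volume_concurrent_bisector (q : Plane) {X : Set Plane} (hX : X.Subsingleton) :
    volume {p : Plane | ∃ x ∈ X, x ∈ bisector s(p, q)} = 0 := by
  rcases hX.eq_empty_or_singleton with rfl | ⟨x, rfl⟩
  · simp
  · refine measure_mono_null ?_ (Measure.addHaar_sphere volume x (dist x q))
    rintro p ⟨_, rfl, hx⟩
    rw [mem_bisector] at hx
    rw [Metric.mem_sphere, dist_comm, hx]

theorem finite_pairs (S : Finset Plane) : (pairs S).Finite :=
  (pairsFinset S).finite_toSet.subset fun _ he => mem_pairsFinset.2 he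

/-- If the two bisectors were parallel, `p`, `q`, `q'` would be collinear, and the bisector of the
pair `q, q'` of `S` would be parallel to them as well. -/
theorem bisector_not_parallel_of_ne {S : Finset Plane} {p q q' : Plane} (hq : q ∈ S)
    (hq' : q' ∈ S) (hqq' : q ≠ q')
    (h : ∀ f ∈ pairs S, ¬ (bisector s(p, q)).Parallel (bisector f)) :
    ¬ (bisector s(p, q)).Parallel (bisector s(p, q')) := by
  intro hpar
  refine h s(q, q') (mk_mem_pairs.2 ⟨hqq', hq, hq'⟩) ?_
  rw [bisector_parallel_mk_iff] at hpar ⊢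
  have h1 : q - p ∈ ℝ ∙ (q - p) := Submodule.mem_span_singleton_self _
  have h2 : q' - p ∈ ℝ ∙ (q - p) := hpar ▸ Submodule.mem_span_singleton_self _
  have h3 : q' - q ∈ ℝ ∙ (q - p) := by
    have := Submodule.sub_mem _ h2 h1
    rwa [sub_sub_sub_cancel_right] at this
  obtain ⟨c, hc⟩ := Submodule.mem_span_singleton.1 h3
  have hc0 : c ≠ 0 := by
    rintro rfl
    rw [zero_smul] at hc
    exact hqq' (sub_eq_zero.1 hc.symm).symm
  rw [← hc, Submodule.span_singleton_smul_eq (IsUnit.mk0 _ hc0)]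

open MeasureTheory in
theorem exists_general_point {S : Finset Plane}
    (hS : ∀ e ∈ pairs S, ∀ f ∈ pairs S, e ≠ f → ¬ (bisector e).Parallel (bisector f)) :
    ∃ p ∉ S, ∀ q ∈ S, (∀ f ∈ pairs S, ¬ (bisector s(p, q)).Parallel (bisector f)) ∧
      ∀ f ∈ pairs S, ∀ g ∈ pairs S, f ≠ g → ∀ x ∈ bisector s(p, q), x ∈ bisector f →
        x ∉ bisector g := by
  have hfin := finite_pairs S
  have hpar : ∀ᵐ p : Plane, ∀ q ∈ S, ∀ f ∈ pairs S,
      ¬ (p ≠ q ∧ (bisector s(p, q)).Parallel (bisector f)) := by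
    rw [Filter.eventually_all_finset]
    intro q _
    rw [Filter.eventually_all_finite hfin]
    intro f _
    exact measure_eq_zero_iff_ae_notMem.1 (volume_parallel_bisector q)
  have hconc : ∀ᵐ p : Plane, ∀ q ∈ S, ∀ f ∈ pairs S, ∀ g ∈ pairs S, f ≠ g →
      ¬ ∃ x ∈ (bisector f : Set Plane) ∩ bisector g, x ∈ bisector s(p, q) := by
    rw [Filter.eventually_all_finset]
    intro q _
    rw [Filter.eventually_all_finite hfin]
    intro f hf
    rw [Filter.eventually_all_finite hfin]
    intro g hg
    rw [Filter.eventually_imp_distrib_left]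
    intro hfg
    exact measure_eq_zero_iff_ae_notMem.1 (volume_concurrent_bisector q
      (inter_bisector_subsingleton hf.1 hg.1 fun h =>
        hS f hf g hg hfg (h ▸ AffineSubspace.Parallel.refl _)))
  have hnot : ∀ᵐ p : Plane, p ∉ (S : Set Plane) :=
    measure_eq_zero_iff_ae_notMem.1 (S.finite_toSet.measure_zero volume)
  obtain ⟨p, hpS, h1, h2⟩ := (hnot.and (hpar.and hconc)).exists
  refine ⟨p, hpS, fun q hq => ⟨fun f hf h => h1 q hq f hf ⟨?_, h⟩, ?_⟩⟩
  · rintro rfl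
    exact hpS hq
  · intro f hf g hg hfg x hx hxf hxg
    exact h2 q hq f hf g hg hfg ⟨x, ⟨hxf, hxg⟩, hx⟩

/-- The absence of parallel bisectors is carried through the induction because it makes distinct
bisectors of `S` meet in at most one point, which the choice of the next point requires. -/
theorem exists_generalCount (n : ℕ) : ∃ S : Finset Plane, S.card = n ∧
    numOrderings S = generalCount n ∧
    ∀ e ∈ pairs S, ∀ f ∈ pairs S, e ≠ f → ¬ (bisector e).Parallel (bisector f) := by
  classical
  induction n with
  | zero =>
    refine ⟨∅, rfl, numOrderings_empty, fun e he => ?_⟩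
    induction e with | _ a b
    simp [mk_mem_pairs] at he
  | succ n ih =>
    obtain ⟨S, hcard, hnum, hS⟩ := ih
    obtain ⟨p, hp, hpS⟩ := exists_general_point hS
    have hpq : ∀ q ∈ S, p ≠ q := by rintro q hq rfl; exact hp hq
    refine ⟨insert p S, by rw [Finset.card_insert_of_notMem hp, hcard], ?_, ?_⟩
    · rw [numOrderings_insert hp, generalCount, hnum, Finset.sum_congr rfl, Finset.sum_const,
        hcard, smul_eq_mul]
      intro q hq
      have hdiag : ¬ s(p, q).IsDiag := hpq q hq
      rw [numRegions_bisector_eq hdiag, Finset.filter_true_of_mem, card_pairsFinset, hcard]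
      · intro f hf
        rw [mem_pairsFinset] at hf
        exact exists_mem_inter_of_not_parallel hdiag hf.1 ((hpS q hq).1 f hf)
      · intro f hf h
        exact (hpS q hq).1 f hf (h ▸ AffineSubspace.Parallel.refl _)
      · exact (hpS q hq).2
    · have hsplit : ∀ e ∈ pairs (insert p S), e ∈ pairs S ∨ ∃ q ∈ S, e = s(p, q) := by
        intro e he
        rw [← mem_pairsFinset, pairsFinset_insert hp, Finset.mem_union, mem_pairsFinset,
          Finset.mem_image] at he
        exact he.imp_right fun ⟨q, hq, h⟩ => ⟨q, hq, h.symm⟩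
      intro e he f hf hef
      rcases hsplit e he with he | ⟨q, hq, rfl⟩ <;> rcases hsplit f hf with hf | ⟨q', hq', rfl⟩
      · exact hS e he f hf hef
      · exact fun h => (hpS q' hq').1 e he h.symm
      · exact (hpS q hq).1 f hf
      · exact bisector_not_parallel_of_ne hq hq' (by rintro rfl; exact hef rfl)
          (hpS q hq).1

theorem maxOrderings_eq_generalCount (n : ℕ) : maxOrderings n = generalCount n := by
  obtain ⟨⟨S, hS, hnum⟩, hub⟩ := isGreatest_maxOrderings n
  obtain ⟨T, hT, hTnum, -⟩ := exists_generalCount n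
  refine le_antisymm ?_ (hub ⟨T, hT, hTnum⟩)
  rw [← hnum, ← hS]
  exact numOrderings_le S

/-! ### Counting the configuration -/

/-- A vertex of a triangle lies on two of its sides, whereas `p` belongs to only one of the three
pairs. Nondegeneracy of the triangle follows because none of the pairs is diagonal. -/
theorem not_concurrent_of_triangle {W : Finset Plane} {p q : Plane} (hp : p ∉ W)
    {f g : Sym2 Plane} (hf : f ∈ pairs W) (hg : g ∈ pairs W) (hpq : p ≠ q)
    {a b c : Plane} (h : ({s(p, q), f, g} : Set (Sym2 Plane)) = {s(a, b), s(b, c), s(c, a)}) :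
    False := by
  have key : ∀ e ∈ ({s(a, b), s(b, c), s(c, a)} : Set (Sym2 Plane)),
      ¬ e.IsDiag ∧ (p ∈ e → e = s(p, q)) := by
    rw [← h]
    rintro e (rfl | rfl | rfl)
    · exact ⟨hpq, fun _ => rfl⟩
    · exact ⟨hf.1, fun hpe => absurd (hf.2 p hpe) hp⟩
    · exact ⟨hg.1, fun hpe => absurd (hg.2 p hpe) hp⟩
  have hmem : s(p, q) ∈ ({s(a, b), s(b, c), s(c, a)} : Set (Sym2 Plane)) := by
    rw [← h]; simp
  have h1 := key s(a, b) (by simp)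
  have h2 := key s(b, c) (by simp)
  have h3 := key s(c, a) (by simp)
  simp only [Sym2.mk_isDiag_iff, Sym2.mem_iff, Sym2.eq_iff] at h1 h2 h3
  simp only [Set.mem_insert_iff, Set.mem_singleton_iff, Sym2.eq_iff] at hmem
  grind

section Config

variable {m k l : ℕ} {U : Finset Plane} {V : Fin l → Finset Plane} {C : Finset Plane}

-- The bisector of `p, q` is crossed by every bisector of `W` except, when `q ∈ V j`, those of pairs
-- in `W ∩ V j`. The crossings are distinct since `p ∉ U` makes the concurrency condition
-- applicable.
open Classical in
theorem IsParallelLinesConfig.numRegions_bisector (hC : IsParallelLinesConfig m k l U V C)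
    {W : Finset Plane} (hWC : W ⊆ C) {p q : Plane} (hp : p ∉ W) (hpU : p ∉ U)
    {j : Fin l} (hpj : p ∈ V j) (hq : q ∈ W) :
    numRegions bisectorMap (bisector s(p, q) : Set Plane) (pairsFinset W) +
      (if q ∈ V j then (W ∩ V j).card.choose 2 else 0) = 1 + W.card.choose 2 := by
  have hpq : p ≠ q := by rintro rfl; exact hp hq
  have hdiag : ¬ s(p, q).IsDiag := hpq
  have heC : s(p, q) ∈ pairs C :=
    mk_mem_pairs.2 ⟨hpq, (hC.mem_iff p).2 (Or.inr ⟨j, hpj⟩), hWC hq⟩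
  have hef : ∀ f ∈ pairs W, s(p, q) ≠ f := by
    rintro f hf rfl
    exact hp (hf.2 p (Sym2.mem_mk_left _ _))
  have hne : ∀ f ∈ pairs W, bisector s(p, q) ≠ bisector f := fun f hf =>
    hC.distinct _ heC f (pairs_mono hWC hf) (hef f hf)
  have hmeet : ∀ f ∈ pairs W, (∃ x ∈ bisector s(p, q), x ∈ bisector f) ↔
      ¬ (q ∈ V j ∧ f ∈ pairs (V j)) := by
    intro f hf
    constructor
    · rintro ⟨x, hx, hxf⟩ ⟨hqj, hfj⟩
      refine hne f hf (AffineSubspace.ext_of_direction_eq ?_ ⟨x, hx, hxf⟩)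
      exact bisector_parallel_iff.1 (bisector_parallel_of_collinear (hC.collinear j)
        (mk_mem_pairs.2 ⟨hpq, hpj, hqj⟩) hfj)
    · intro h
      refine exists_mem_inter_of_not_parallel hdiag hf.1 fun hpar => h ?_
      obtain ⟨i, hi, hfi⟩ := hC.not_parallel _ heC f (pairs_mono hWC hf) (hef f hf) hpar
      rw [mk_mem_pairs] at hi
      have hij : i = j := by
        by_contra hij
        exact Finset.disjoint_left.1 (hC.disjoint_line i j hij) hi.2.1 hpj
      subst hij
      exact ⟨hi.2.2, hfi⟩
  rw [numRegions_bisector_eq hdiag hne, ← card_pairsFinset W, add_assoc]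
  · congr 1
    rw [Finset.filter_congr fun f hf => hmeet f (mem_pairsFinset.1 hf)]
    have hcompl := Finset.card_filter_add_card_filter_not (s := pairsFinset W)
      (fun f => q ∈ V j ∧ f ∈ pairs (V j))
    rw [← hcompl, add_comm]
    congr 1
    split_ifs with hqj
    · rw [← card_pairsFinset]
      congr 1
      ext f
      rw [Finset.mem_filter, mem_pairsFinset, mem_pairsFinset]
      simp only [hqj, true_and, pairs, Set.mem_ofPred_eq, Finset.mem_inter]
      grind
    · simp [hqj]
  · intro f hf g hg hfg x hx hxf hxg
    obtain ⟨a, b, c, habc⟩ := hC.concurrent _ heC f (pairs_mono hWC hf) g (pairs_mono hWC hg)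
      (hef f hf) hfg (hef g hg) (fun h => hpU (h.1.2 p (Sym2.mem_mk_left _ _))) ⟨x, hx, hxf, hxg⟩
    exact not_concurrent_of_triangle hp hf hg hpq habc

-- The induction starts at `U`, where freeness gives the exact count whatever concurrencies its
-- bisectors have; every later point lies on one of the lines.
open Classical in
theorem IsParallelLinesConfig.numOrderings_union_add (hC : IsParallelLinesConfig m k l U V C)
    (T : Finset Plane) (hT : T ⊆ C) (hTU : Disjoint U T) :
    numOrderings (U ∪ T) + ∑ j, collinearLoss ((U ∪ T) ∩ V j).card =
      generalCount (U ∪ T).card := by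
  induction T using Finset.induction_on with
  | empty =>
    have h : ∀ j, U ∩ V j = ∅ := fun j => Finset.disjoint_iff_inter_eq_empty.1 (hC.disjoint_free j)
    have hU : numOrderings U = maxOrderings U.card := hC.free
    simp [h, collinearLoss, hU, maxOrderings_eq_generalCount]
  | insert p T hpT ih =>
    rw [Finset.insert_subset_iff] at hT
    rw [Finset.disjoint_insert_right] at hTU
    have ih := ih hT.2 hTU.2
    have hUC : U ⊆ C := fun x hx => (hC.mem_iff x).2 (Or.inl hx)
    have hWC : U ∪ T ⊆ C := Finset.union_subset hUC hT.2
    have hpW : p ∉ U ∪ T := by simp [hTU.1, hpT]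
    obtain ⟨j, hj⟩ := ((hC.mem_iff p).1 hT.1).resolve_left hTU.1
    rw [Finset.union_insert]
    set W := U ∪ T
    -- Only the line containing `p` incurs a new loss: one `choose 2` for each point of `W` already
    -- on it.
    have hloss : ∀ i, collinearLoss (insert p W ∩ V i).card = collinearLoss (W ∩ V i).card +
        if i = j then (W ∩ V j).card * (W ∩ V j).card.choose 2 else 0 := by
      intro i
      split_ifs with hij
      · subst hij
        rw [Finset.insert_inter_of_mem hj, Finset.card_insert_of_notMem (by simp [hpW]),
          collinearLoss]
      · rw [Finset.insert_inter_of_notMem, add_zero]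
        exact Finset.disjoint_right.1 (hC.disjoint_line i j hij) hj
    have hsum := Finset.sum_congr (rfl : W = W) fun q hq =>
      hC.numRegions_bisector hWC hpW hTU.1 hj hq
    rw [Finset.sum_add_distrib, Finset.sum_ite_mem, Finset.sum_const, Finset.sum_const, smul_eq_mul,
      smul_eq_mul] at hsum
    rw [numOrderings_insert hpW, Finset.card_insert_of_notMem hpW, generalCount,
      Finset.sum_congr rfl fun i _ => hloss i, Finset.sum_add_distrib,
      Finset.sum_ite_eq' Finset.univ j, if_pos (Finset.mem_univ j), ← ih, ← hsum]
    ring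

theorem IsParallelLinesConfig.card_eq (hC : IsParallelLinesConfig m k l U V C) :
    C.card = m + k * l := by
  classical
  have h : C = U ∪ Finset.univ.biUnion V := by
    ext p
    simp [hC.mem_iff p]
  rw [h, Finset.card_union_of_disjoint, hC.card_free, Finset.card_biUnion]
  · simp [hC.card_line, mul_comm]
  · exact fun i _ j _ hij => hC.disjoint_line i j hij
  · simpa [Finset.disjoint_biUnion_right] using hC.disjoint_free

theorem IsParallelLinesConfig.numOrderings_add (hC : IsParallelLinesConfig m k l U V C) :
    numOrderings C + l * collinearLoss k = generalCount (m + k * l) := by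
  classical
  have hUC : U ⊆ C := fun x hx => (hC.mem_iff x).2 (Or.inl hx)
  have h := hC.numOrderings_union_add (C \ U) Finset.sdiff_subset Finset.disjoint_sdiff
  have hV : ∀ j, C ∩ V j = V j := fun j =>
    Finset.inter_eq_right.2 fun x hx => (hC.mem_iff x).2 (Or.inr ⟨j, hx⟩)
  rw [Finset.union_sdiff_of_subset hUC, hC.card_eq] at h
  simpa [hV, hC.card_line] using h

end Config

theorem propositionP (m k l n : ℕ) (U : Finset Plane) (V : Fin l → Finset Plane)
    (C : Finset Plane) (hC : IsParallelLinesConfig m k l U V C) (hn : n = m + k * l) :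
    C.card = n ∧
    (numOrderings C : ℚ) =
      (18 * k ^ 2 * l ^ 2 * m ^ 2 + 12 * k ^ 3 * l ^ 3 * m - 30 * k ^ 2 * l ^ 2 * m
        + 3 * k ^ 4 * l ^ 4 - 10 * k ^ 3 * l ^ 3 + 21 * k ^ 2 * l ^ 2 - 3 * k ^ 4 * l
        + 10 * k ^ 3 * l - 9 * k ^ 2 * l + 12 * k * l * m ^ 3 - 30 * k * l * m ^ 2
        + 42 * k * l * m - 12 * k * l + 3 * m ^ 4 - 10 * m ^ 3 + 21 * m ^ 2 - 14 * m + 24) / 24 ∧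
    (numOrderings C : ℤ) = (maxOrderings n : ℤ) - l * stirlingOne k ((k : ℤ) - 2) := by
  subst hn
  have h := hC.numOrderings_add
  refine ⟨hC.card_eq, ?_, ?_⟩
  · have hq : (numOrderings C : ℚ) + l * collinearLoss k = generalCount (m + k * l) := by
      exact_mod_cast h
    rw [cast_generalCount, cast_collinearLoss] at hq
    rw [eq_sub_of_add_eq hq]
    push_cast
    ring
  · rw [stirlingOne_sub_two, maxOrderings_eq_generalCount, ← h]
    push_cast
    ring
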